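/- Let $\Sigma=\mathbb H^2/\Gamma$ be a complete oriented hyperbolic surface of finite area, where $\Gamma$ is a discrete group of orientation preserving isometries acting freely on the hyperbolic plane $\mathbb H^2$. Its punctures are the $\Gamma$-orbits of fixed points of parabolic elements of $\Gamma$ (these fixed points are the lifts of the punctures). Let $\Sigma$ be decorated: each puncture $u$ is given a number $r(u)>0$, to be thought of as a choice of the closed horocycle of length $r(u)$ around $u$. Let $\alpha$ be a geodesic arc in $\Sigma$, possibly with self-intersections, both of whose ends go to the same puncture $v$, and put $r=r(v)$. The length $a$ of $\alpha$ is the signed length of the segment of a lift of $\alpha$ to $\mathbb H^2$ between the horocycles of the decoration at the two ends of the lift, taken positive if these two horocycles do not intersect and negative if they do. The two resolutions $\alpha_1,\alpha_2$ of $\alpha$ at $v$ are the closed curves in $\Sigma$ obtained by going along $\alpha$ toward $v$ and then, near $v$, turning left (respectively right) around $v$, by less than a full turn, until the initial end of $\alpha$ is reached. For a closed curve $\beta$ let the length of its geodesic representative be the length of a closed geodesic freely homotopic to $\beta$ (possibly multiply traversed), and let it be $0$ if $\beta$ is freely homotopic to a nonzero multiple of a circle around a puncture. Then $a$ and the resolutions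 $\alpha_1,\alpha_2$ exist, each resolution has a geodesic representative in this sense, and, if $x$ and $y$ are the lengths of the geodesic representatives of $\alpha_1$ and $\alpha_2$, $$e^{\frac a2}=\frac 2r\Bigl(\cosh\frac x2+\cosh\frac y2\Bigr).$$ In particular the formula holds when one or both of the resolutions are (multiples of) circles around a puncture. -/

import Mathlib

open scoped MatrixGroups UpperHalfPlane unitInterval

noncomputable section

/-! ### Closed curves and free homotopy -/

/-- A closed curve in `X`: a path from a point to itself. -/
structure ClosedCurve (X : Type*) [TopologicalSpace X] where
  base : X
  path : Path base base

/-- Free homotopy of closed curves (through closed curves, the base point may move). -/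
def ClosedCurve.FreelyHomotopic {X : Type*} [TopologicalSpace X] (β δ : ClosedCurve X) : Prop :=
  ∃ H : C(I × I, X), (∀ t, H (0, t) = β.path t) ∧ (∀ t, H (1, t) = δ.path t) ∧
    ∀ s, H (s, 0) = H (s, 1)

/-- The restriction of a continuous curve `f : ℝ → X` to the segment from `a` to `b`
(run backwards if `b < a`), as a path. -/
def segmentPath {X : Type*} [TopologicalSpace X] (f : ℝ → X) (hf : Continuous f) (a b : ℝ) :
    Path (f a) (f b) where
  toFun t := f ((1 - (t : ℝ)) * a + (t : ℝ) * b)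
  continuous_toFun := hf.comp (by fun_prop)
  source' := by simp
  target' := by simp

/-- The closed curve obtained by following a curve `f : ℝ → X` from parameter `0` to a period
`L` of `f`. -/
def closedCurveOfPeriodic {X : Type*} [TopologicalSpace X] (f : ℝ → X) (hf : Continuous f)
    (L : ℝ) (hL : Function.Periodic f L) : ClosedCurve X where
  base := f 0
  path := (segmentPath f hf 0 L).cast rfl (by simpa using (hL 0).symm)

/-- For `f : ℝ → X` a curve parametrized by arc length: `f` closes up, and `r` is the length of
the closed curve it runs along, traversed exactly once. -/
def ClosesUpWithLength {X : Type*} (f : ℝ → X) (r : ℝ) : Prop :=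
  0 < r ∧ Function.Periodic f r ∧ ∀ s, 0 < s → Function.Periodic f s → r ≤ s

/-! ### Geodesics and horocycles of the hyperbolic plane

The metric is the hyperbolic metric `(dx² + dy²) / y²` of the upper half-plane `ℍ`, whose boundary
at infinity is `OnePoint ℝ`; `SL(2, ℝ)` acts by orientation preserving isometries. The geodesic and
the horocycles below are parametrized by arc length. -/

/-- The point `(u + i) eᵗ`: start at the point `i eᵗ` of the geodesic from `0` to `∞` and move by
arc length `u` along the horocycle centred at `∞`, to the right as seen when facing `∞`. -/
def stdPoint (t u : ℝ) : ℍ :=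
  ⟨⟨u * Real.exp t, Real.exp t⟩, Real.exp_pos t⟩

/-- The oriented geodesic of `ℍ` from `g • 0` to `g • ∞`, parametrized by arc length. Every
oriented geodesic with a unit speed parametrization is of this form. -/
def geodesicH (g : SL(2, ℝ)) (t : ℝ) : ℍ := g • stdPoint t 0

/-- The horocycle of `ℍ` centred at the forward end `g • ∞` of the geodesic `geodesicH g`, through
the point at time `t` of that geodesic, parametrized by arc length `u` with `u = 0` at that point;
increasing `u` moves to the right as seen when facing the centre. -/
def horocycleH (g : SL(2, ℝ)) (t u : ℝ) : ℍ := g • stdPoint t u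

/-- The rotation by `π` about `i`. Replacing `g` by `g * halfTurn` reverses the geodesic:
`geodesicH (g * halfTurn) t = geodesicH g (-t)`. -/
def halfTurn : SL(2, ℝ) := ⟨!![0, -1; 1, 0], by simp [Matrix.det_fin_two]⟩

/-! ### Decorated hyperbolic surfaces -/

/-- A complete oriented hyperbolic surface of finite area, presented as the quotient of its
universal cover `ℍ` by its group of deck transformations, together with a decoration. -/
structure DecoratedHyperbolicSurface where
  /-- The group of deck transformations (its image in `PSL(2, ℝ)` acts; `-1` may or may not belong
  to the group). -/
  Γ : Subgroup SL(2, ℝ)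
  discrete : DiscreteTopology Γ
  /-- The action of the image of `Γ` in `PSL(2, ℝ)` is free. -/
  free : ∀ γ ∈ Γ, (∃ z : ℍ, γ • z = z) → ∀ w : ℍ, γ • w = w
  /-- The quotient has finite area. -/
  finite_area : ∃ F : Set ℍ, MeasurableSet F ∧ MeasureTheory.volume F < ⊤ ∧
    ∀ z : ℍ, ∃ γ ∈ Γ, γ • z ∈ F
  /-- The decoration: the length of the horocycle at each puncture. The punctures are the orbits
  of the parabolic fixed points of the group. -/
  r : CuspOrbits (Γ.map Matrix.SpecialLinearGroup.toGL) → ℝ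
  r_pos : ∀ v, 0 < r v

namespace DecoratedHyperbolicSurface

variable (S : DecoratedHyperbolicSurface)

/-- The underlying surface `ℍ / Γ`, with the quotient topology. -/
abbrev Surface : Type := MulAction.orbitRel.Quotient S.Γ ℍ

/-- The universal covering `ℍ → ℍ / Γ`. -/
def proj (z : ℍ) : S.Surface := Quotient.mk _ z

/-- `Γ`, as a group of invertible matrices acting on the boundary `OnePoint ℝ`. -/
abbrev boundaryGroup : Subgroup (GL (Fin 2) ℝ) := S.Γ.map Matrix.SpecialLinearGroup.toGL

/-- The set of punctures: orbits of parabolic fixed points. -/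
abbrev Puncture : Type := CuspOrbits S.boundaryGroup

/-- The puncture of which the parabolic fixed point `c` is a lift. -/
def punctureOf (c : OnePoint ℝ) (hc : IsCusp c S.boundaryGroup) : S.Puncture :=
  Quotient.mk _ ⟨c, hc⟩

/-- The geodesic of the surface covered by `geodesicH g`. -/
def geodesic (g : SL(2, ℝ)) (t : ℝ) : S.Surface := S.proj (geodesicH g t)

/-- The curve in the surface covered by the horocycle `horocycleH g t`. -/
def horocycle (g : SL(2, ℝ)) (t u : ℝ) : S.Surface := S.proj (horocycleH g t u)

end DecoratedHyperbolicSurface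

theorem continuous_stdPoint : Continuous fun p : ℝ × ℝ => stdPoint p.1 p.2 := by
  rw [UpperHalfPlane.isEmbedding_coe.continuous_iff]
  have h : (UpperHalfPlane.coe ∘ fun p : ℝ × ℝ => stdPoint p.1 p.2) =
      fun p : ℝ × ℝ => ((p.2 * Real.exp p.1 : ℝ) : ℂ) + (Real.exp p.1 : ℝ) * Complex.I := by
    funext p
    apply Complex.ext <;> simp [stdPoint, -Complex.ofReal_exp]
  rw [h]
  fun_prop

theorem halfTurn_smul_stdPoint (t : ℝ) : halfTurn • stdPoint (-t) 0 = stdPoint t 0 := by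
  apply UpperHalfPlane.ext
  rw [UpperHalfPlane.coe_specialLinearGroup_apply]
  have h : ((stdPoint (-t) 0 : ℍ) : ℂ) = (Real.exp (-t) : ℝ) * Complex.I := by
    apply Complex.ext <;> simp [stdPoint, -Complex.ofReal_exp]
  have h' : ((stdPoint t 0 : ℍ) : ℂ) = (Real.exp t : ℝ) * Complex.I := by
    apply Complex.ext <;> simp [stdPoint, -Complex.ofReal_exp]
  rw [h, h']
  have e : (Real.exp t : ℂ) * (Real.exp (-t) : ℝ) = 1 := by
    rw [← Complex.ofReal_mul, ← Real.exp_add]; simp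
  have hne : ((Real.exp (-t) : ℝ) : ℂ) ≠ 0 := by
    exact_mod_cast (Real.exp_pos (-t)).ne'
  simp only [halfTurn]
  simp [-Complex.ofReal_exp]
  field_simp
  rw [Complex.I_sq]
  linear_combination (-1 : ℂ) * (-e)

namespace DecoratedHyperbolicSurface

variable (S : DecoratedHyperbolicSurface)

theorem continuous_proj : Continuous S.proj := continuous_quotient_mk'

theorem continuous_geodesic (g : SL(2, ℝ)) : Continuous (S.geodesic g) :=
  S.continuous_proj.comp ((continuous_const_smul g).comp
    (continuous_stdPoint.comp (by fun_prop : Continuous fun t : ℝ => (t, (0 : ℝ)))))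

theorem continuous_horocycle (g : SL(2, ℝ)) (t : ℝ) : Continuous (S.horocycle g t) :=
  S.continuous_proj.comp ((continuous_const_smul g).comp
    (continuous_stdPoint.comp (by fun_prop : Continuous fun u : ℝ => (t, u))))

/-- `x` is the length of the geodesic representative of the closed curve `β`: either `x > 0` and
`β` is freely homotopic to a closed geodesic of length `x` (possibly a multiple of a shorter one),
or `β` is freely homotopic to a closed horocycle around a puncture (run any nonzero number of times,
in either direction), in which case the length is `0`. -/
def HasGeodesicLength (β : ClosedCurve S.Surface) (x : ℝ) : Prop :=
  (0 < x ∧ ∃ (g : SL(2, ℝ)) (h : Function.Periodic (S.geodesic g) x),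
    β.FreelyHomotopic (closedCurveOfPeriodic (S.geodesic g) (S.continuous_geodesic g) x h)) ∨
  (x = 0 ∧ ∃ (g : SL(2, ℝ)) (L : ℝ) (h : Function.Periodic (S.horocycle g 0) L), L ≠ 0 ∧
    β.FreelyHomotopic
      (closedCurveOfPeriodic (S.horocycle g 0) (S.continuous_horocycle g 0) L h))

/-- A geodesic arc between punctures of the surface: a complete geodesic both of whose ends go to
punctures, given by an oriented lift to `ℍ`. It may intersect itself. -/
structure GeodesicArc where
  frame : SL(2, ℝ)
  source_isCusp : IsCusp ((frame : GL (Fin 2) ℝ) • ((0 : ℝ) : OnePoint ℝ)) S.boundaryGroup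
  target_isCusp : IsCusp ((frame : GL (Fin 2) ℝ) • (OnePoint.infty : OnePoint ℝ)) S.boundaryGroup

namespace GeodesicArc

variable {S} (α : S.GeodesicArc)

/-- The puncture from which the arc starts. -/
def source : S.Puncture := S.punctureOf _ α.source_isCusp

/-- The puncture at which the arc ends. -/
def target : S.Puncture := S.punctureOf _ α.target_isCusp

/-- The arc in the surface, parametrized by arc length. -/
def curve (t : ℝ) : S.Surface := S.geodesic α.frame t

/-- The horocycle around the target puncture that crosses the final end of the arc at time `t`. -/
def endHorocycle (t u : ℝ) : S.Surface := S.horocycle α.frame t u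

/-- The horocycle around the source puncture that crosses the initial end of the arc at time `t`. -/
def startHorocycle (t u : ℝ) : S.Surface := S.horocycle (α.frame * halfTurn) (-t) u

/-- `a` is the length of the arc for the decoration: the signed length of the segment between the
horocycles of the decoration at the two ends of a lift, which is negative if the segment runs
from the second horocycle to the first one, that is, if the two (lifted) horocycles intersect. -/
def HasLength (a : ℝ) : Prop :=
  ∃ t₀ t₁ : ℝ, ClosesUpWithLength (α.startHorocycle t₀) (S.r α.source) ∧
    ClosesUpWithLength (α.endHorocycle t₁) (S.r α.target) ∧ a = t₁ - t₀

theorem continuous_curve : Continuous α.curve := S.continuous_geodesic _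

theorem continuous_endHorocycle (t : ℝ) : Continuous (α.endHorocycle t) :=
  S.continuous_horocycle _ _

theorem endHorocycle_zero (t : ℝ) : α.endHorocycle t 0 = α.curve t := rfl

theorem startHorocycle_zero (t : ℝ) : α.startHorocycle t 0 = α.curve t := by
  simp only [startHorocycle, horocycle, horocycleH, curve, geodesic, geodesicH, mul_smul,
    halfTurn_smul_stdPoint]

/-- Both ends of the arc, cut off at the times `t₀ < t₁`, meet one and the same closed horocycle, of
length `ρ`, and running along it by (signed) arc length `s` leads from the final end of the arc to
its initial end. -/
def Joins (t₀ t₁ ρ s : ℝ) : Prop :=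
  t₀ < t₁ ∧ ClosesUpWithLength (α.endHorocycle t₁) ρ ∧
    ∀ u, α.endHorocycle t₁ (s + u) = α.startHorocycle t₀ u

theorem Joins.endpoint {α : S.GeodesicArc} {t₀ t₁ ρ s : ℝ} (h : α.Joins t₀ t₁ ρ s) :
    α.endHorocycle t₁ s = α.curve t₀ := by
  have := h.2.2 0
  rwa [add_zero, startHorocycle_zero] at this

/-- Follow the arc from time `t₀` to time `t₁`, then the horocycle by arc length `s` back to the
starting point. -/
def resolution (t₀ t₁ ρ s : ℝ) (h : α.Joins t₀ t₁ ρ s) : ClosedCurve S.Surface where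
  base := α.curve t₀
  path := (segmentPath α.curve α.continuous_curve t₀ t₁).trans
    ((segmentPath (α.endHorocycle t₁) (α.continuous_endHorocycle t₁) 0 s).cast
      (α.endHorocycle_zero t₁).symm h.endpoint.symm)

/-- `β` is the resolution, at the common puncture of the two ends of `α`, obtained by going along
`α` toward the puncture and turning left around it (by less than a full turn) until the other end
of `α` is reached. -/
def IsLeftResolution (β : ClosedCurve S.Surface) : Prop :=
  ∃ (t₀ t₁ ρ s : ℝ) (h : α.Joins t₀ t₁ ρ s), -ρ < s ∧ s < 0 ∧ β = α.resolution t₀ t₁ ρ s h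

/-- The resolution obtained by turning right instead. -/
def IsRightResolution (β : ClosedCurve S.Surface) : Prop :=
  ∃ (t₀ t₁ ρ s : ℝ) (h : α.Joins t₀ t₁ ρ s), 0 < s ∧ s < ρ ∧ β = α.resolution t₀ t₁ ρ s h

end GeodesicArc

end DecoratedHyperbolicSurface

end

/-! Free homotopy classes of closed curves in ℍ/Γ correspond to conjugacy classes of deck
transformations, and up to sign the trace reads off the length: it is `2 cosh (x/2)` for a closed
geodesic of length `x` and 2 for a circle around a puncture (`HasGeodesicLength.abs_trace`).

In the coordinate where the arc runs from 0 to ∞, cut at times `t₀ < t₁` and closed by horocyclic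
arc length `s`, a resolution has holonomy `dilation t₁ * shear s * dilation t₀ * halfTurn`, whose
trace is `s * exp ((t₁ - t₀) / 2)` (`trace_resolutionMatrix`). If the closed horocycle used has
length `ρ`, then `ρ * exp ((t₁ - t₀) / 2)` does not depend on which horocycle it is, so it equals `r
* exp (a / 2)` for the decoration. Hence `2 cosh (x/2) = (|s| / ρ) * r * exp (a / 2)`
(`Joins.two_mul_cosh`). The left and right turns use complementary fractions `|s| / ρ` of a full
turn (`Joins.full_turn`), so adding the two equations gives the formula.

Existence also comes from the group. A deck transformation matching the two ends can be composed
with parabolic ones until `0 < s < ρ`; the value `s = 0` would give an element of trace 0, hence a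
fixed point in ℍ, against freeness. Freeness likewise excludes |trace| < 2 for every resolution, so
its holonomy is conjugate, up to sign, to a dilation or a shear. Both act affinely on ℍ, and a
straight-line homotopy of lifts yields the geodesic representative. -/

noncomputable section

/-! ### Dilations, shears and fixed points in SL(2, ℝ) -/

/-- The translation of length `t` along the geodesic from `0` to `∞`. -/
def dilation (t : ℝ) : SL(2, ℝ) :=
  ⟨!![Real.exp (t / 2), 0; 0, Real.exp (-(t / 2))], by
    simp [Matrix.det_fin_two, ← Real.exp_add]⟩

/-- The parabolic isometry `z ↦ z + u`. -/
def shear (u : ℝ) : SL(2, ℝ) := ⟨!![1, u; 0, 1], by simp [Matrix.det_fin_two]⟩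

theorem SL2_mul_apply (g h : SL(2, ℝ)) (i j : Fin 2) :
    (g * h) i j = g i 0 * h 0 j + g i 1 * h 1 j := by
  change ((g : Matrix (Fin 2) (Fin 2) ℝ) * (h : Matrix (Fin 2) (Fin 2) ℝ)) i j = _
  rw [Matrix.mul_apply, Fin.sum_univ_two]

theorem SL2_ext {g h : SL(2, ℝ)} (h00 : g 0 0 = h 0 0) (h01 : g 0 1 = h 0 1)
    (h10 : g 1 0 = h 1 0) (h11 : g 1 1 = h 1 1) : g = h := by
  ext i j; fin_cases i <;> fin_cases j <;> assumption

theorem coe_stdPoint (t u : ℝ) :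
    ((stdPoint t u : ℍ) : ℂ) = (u + Complex.I) * (Real.exp t : ℝ) := by
  apply Complex.ext <;> simp [stdPoint, -Complex.ofReal_exp]

theorem coe_dilation_smul (t : ℝ) (z : ℍ) :
    ((dilation t • z : ℍ) : ℂ) = (Real.exp t : ℝ) * z := by
  have h : Real.exp t * Real.exp (-(t / 2)) = Real.exp (t / 2) := by
    rw [← Real.exp_add]; ring_nf
  rw [UpperHalfPlane.coe_specialLinearGroup_apply]
  have h0 : ((Real.exp (-(t / 2)) : ℝ) : ℂ) ≠ 0 := by exact_mod_cast (Real.exp_pos _).ne'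
  simp only [dilation, Algebra.algebraMap_self, RingHom.id_apply, Matrix.SpecialLinearGroup.coe_mk,
    Matrix.of_apply, Matrix.cons_val', Matrix.cons_val_zero, Matrix.cons_val_one,
    Matrix.cons_val_fin_one, Complex.ofReal_zero, add_zero, zero_mul, zero_add]
  rw [div_eq_iff h0, ← h]
  push_cast
  ring

theorem coe_shear_smul (u : ℝ) (z : ℍ) : ((shear u • z : ℍ) : ℂ) = z + u := by
  rw [UpperHalfPlane.coe_specialLinearGroup_apply]
  simp [shear]

theorem dilation_smul_stdPoint (x t u : ℝ) : dilation x • stdPoint t u = stdPoint (t + x) u := by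
  apply UpperHalfPlane.ext
  rw [coe_dilation_smul, coe_stdPoint, coe_stdPoint, Real.exp_add]
  push_cast
  ring

theorem shear_smul_stdPoint (s t u : ℝ) :
    shear (s * Real.exp t) • stdPoint t u = stdPoint t (u + s) := by
  apply UpperHalfPlane.ext
  rw [coe_shear_smul, coe_stdPoint, coe_stdPoint]
  push_cast
  ring

theorem shear_zero : shear 0 = 1 := by
  ext i j; fin_cases i <;> fin_cases j <;> simp [shear]

theorem dilation_zero : dilation 0 = 1 := by
  ext i j; fin_cases i <;> fin_cases j <;> simp [dilation]

theorem shear_add (u v : ℝ) : shear (u + v) = shear u * shear v := by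
  apply SL2_ext <;> simp [SL2_mul_apply] <;> simp [shear, add_comm]

theorem shear_neg (u : ℝ) : shear (-u) = (shear u)⁻¹ := by
  rw [eq_inv_iff_mul_eq_one, ← shear_add, neg_add_cancel, shear_zero]

theorem dilation_add (s t : ℝ) : dilation (s + t) = dilation s * dilation t := by
  apply SL2_ext <;> simp [SL2_mul_apply] <;> simp [dilation, ← Real.exp_add] <;> ring_nf

theorem dilation_neg (s : ℝ) : dilation (-s) = (dilation s)⁻¹ := by
  rw [eq_inv_iff_mul_eq_one, ← dilation_add, neg_add_cancel, dilation_zero]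

theorem shear_injective : Function.Injective shear := fun u v h => by
  simpa [shear] using congrArg (fun g : SL(2, ℝ) => g 0 1) h

theorem continuous_shear : Continuous shear := by
  refine Continuous.subtype_mk ?_ _
  refine continuous_matrix fun i j => ?_
  fin_cases i <;> fin_cases j <;> simp <;> fun_prop

theorem dilation_mul_shear (t s : ℝ) :
    dilation t * shear s = shear (s * Real.exp t) * dilation t := by
  have h : Real.exp t * Real.exp (-(t / 2)) = Real.exp (t / 2) := by
    rw [← Real.exp_add]; ring_nf
  apply SL2_ext <;> simp [SL2_mul_apply] <;> simp [dilation, shear, mul_assoc, h, mul_comm]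

theorem halfTurn_mul_halfTurn : halfTurn * halfTurn = -1 := by
  apply SL2_ext <;> simp [SL2_mul_apply] <;> simp [halfTurn]

theorem halfTurn_inv : halfTurn⁻¹ = -halfTurn := by
  rw [inv_eq_iff_mul_eq_one, mul_neg, halfTurn_mul_halfTurn, neg_neg]

/-- The fixed points of an isometry are the roots of a quadratic polynomial. -/
theorem smul_eq_self_iff_re_im (g : SL(2, ℝ)) (z : ℍ) :
    g • z = z ↔ g 0 0 * z.re + g 0 1 = z.re * (g 1 0 * z.re + g 1 1) - g 1 0 * z.im ^ 2 ∧
      g 0 0 * z.im = 2 * g 1 0 * z.re * z.im + g 1 1 * z.im := by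
  have h : ((g 1 0 : ℝ) : ℂ) * z + (g 1 1 : ℝ) ≠ 0 := UpperHalfPlane.denom_ne_zero g z
  rw [UpperHalfPlane.ext_iff, UpperHalfPlane.coe_specialLinearGroup_apply]
  simp only [Algebra.algebraMap_self, RingHom.id_apply]
  rw [div_eq_iff h, Complex.ext_iff]
  simp
  constructor
  · rintro ⟨h1, h2⟩; exact ⟨by linear_combination h1, by linear_combination h2⟩
  · rintro ⟨h1, h2⟩; exact ⟨by linear_combination h1, by linear_combination h2⟩

theorem SL2_det (g : SL(2, ℝ)) : g 0 0 * g 1 1 - g 0 1 * g 1 0 = 1 := by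
  rw [← Matrix.det_fin_two]; exact g.det_coe

theorem eq_one_or_neg_one_of_scalar {g : SL(2, ℝ)} (h01 : g 0 1 = 0) (h10 : g 1 0 = 0)
    (h : g 0 0 = g 1 1) : g = 1 ∨ g = -1 := by
  have hd := SL2_det g
  rw [h01, h, zero_mul, sub_zero, mul_self_eq_one_iff] at hd
  rcases hd with hd | hd
  · left; apply SL2_ext <;> simp [*]
  · right; apply SL2_ext <;> simp [*]

/-- An orientation preserving isometry with two fixed points in `ℍ` is the identity. -/
theorem eq_one_or_neg_one_of_smul_eq {g : SL(2, ℝ)} {z w : ℍ} (hzw : z ≠ w)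
    (hz : g • z = z) (hw : g • w = w) : g = 1 ∨ g = -1 := by
  rw [smul_eq_self_iff_re_im] at hz hw
  obtain ⟨hz1, hz2⟩ := hz
  obtain ⟨hw1, hw2⟩ := hw
  have hz3 : g 0 0 = 2 * g 1 0 * z.re + g 1 1 := by
    apply mul_right_cancel₀ z.im_pos.ne'; linear_combination hz2
  have hw3 : g 0 0 = 2 * g 1 0 * w.re + g 1 1 := by
    apply mul_right_cancel₀ w.im_pos.ne'; linear_combination hw2
  by_cases hc : g 1 0 = 0
  · rw [hc] at hz3 hz1
    apply eq_one_or_neg_one_of_scalar _ hc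
    · linarith
    · have : g 0 0 = g 1 1 := by linarith
      rw [this] at hz1; linarith
  · exfalso
    have hre : z.re = w.re := by
      apply mul_left_cancel₀ hc; linarith
    have him : z.im ^ 2 = w.im ^ 2 := by
      apply mul_left_cancel₀ hc
      rw [hre] at hz1
      linarith
    exact hzw (UpperHalfPlane.ext_re_im hre ((sq_eq_sq₀ z.im_pos.le w.im_pos.le).1 him))

theorem stdPoint_injective {t u t' u' : ℝ} (h : stdPoint t u = stdPoint t' u') :
    t = t' ∧ u = u' := by
  have him : Real.exp t = Real.exp t' := congrArg UpperHalfPlane.im h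
  have hre : u * Real.exp t = u' * Real.exp t' := congrArg UpperHalfPlane.re h
  rw [him] at hre
  exact ⟨Real.exp_injective him, mul_right_cancel₀ (Real.exp_pos _).ne' hre⟩

theorem abs_eq_of_eq_or_neg {g h : SL(2, ℝ)} (hg : g = h ∨ g = -h) :
    |Matrix.trace (g : Matrix (Fin 2) (Fin 2) ℝ)| =
      |Matrix.trace (h : Matrix (Fin 2) (Fin 2) ℝ)| := by
  rcases hg with rfl | rfl
  · rfl
  · simp

theorem trace_conj (g h : SL(2, ℝ)) :
    Matrix.trace ((g * h * g⁻¹ : SL(2, ℝ)) : Matrix (Fin 2) (Fin 2) ℝ) =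
      Matrix.trace (h : Matrix (Fin 2) (Fin 2) ℝ) := by
  rw [Matrix.SpecialLinearGroup.coe_mul, Matrix.trace_mul_comm, ← Matrix.SpecialLinearGroup.coe_mul,
    ← mul_assoc, inv_mul_cancel, one_mul]

theorem trace_dilation (x : ℝ) :
    Matrix.trace (dilation x : Matrix (Fin 2) (Fin 2) ℝ) = 2 * Real.cosh (x / 2) := by
  simp [dilation, Matrix.trace_fin_two, Real.cosh_eq]
  ring

theorem trace_shear (x : ℝ) : Matrix.trace (shear x : Matrix (Fin 2) (Fin 2) ℝ) = 2 := by
  simp [shear, Matrix.trace_fin_two]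
  norm_num

/-! ### The deck group and the universal covering -/

namespace DecoratedHyperbolicSurface

variable (S : DecoratedHyperbolicSurface)

/-- The matrices representing deck transformations: the group generated by `Γ` and `-1`. -/
def deck : Subgroup SL(2, ℝ) where
  carrier := {g | g ∈ S.Γ ∨ -g ∈ S.Γ}
  mul_mem' := by
    rintro a b (ha | ha) (hb | hb)
    · exact Or.inl (mul_mem ha hb)
    · exact Or.inr (by simpa using mul_mem ha hb)
    · exact Or.inr (by simpa using mul_mem ha hb)
    · exact Or.inl (by simpa using mul_mem ha hb)
  one_mem' := Or.inl (one_mem _)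
  inv_mem' := by
    rintro a (ha | ha)
    · exact Or.inl (inv_mem ha)
    · exact Or.inr (by simpa using inv_mem ha)

variable {S}

theorem mem_deck_iff {g : SL(2, ℝ)} : g ∈ S.deck ↔ g ∈ S.Γ ∨ -g ∈ S.Γ := Iff.rfl

theorem mem_deck_of_mem {g : SL(2, ℝ)} (h : g ∈ S.Γ) : g ∈ S.deck := Or.inl h

@[simp] theorem neg_mem_deck_iff {g : SL(2, ℝ)} : -g ∈ S.deck ↔ g ∈ S.deck := by
  rw [mem_deck_iff, mem_deck_iff, neg_neg, or_comm]

theorem SL2_neg_smul (g : SL(2, ℝ)) (z : ℍ) : -g • z = g • z :=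
  have h : Matrix.SpecialLinearGroup.toGL (-g) = -Matrix.SpecialLinearGroup.toGL g := by
    ext i j; simp
  (congrArg (· • z) h).trans (UpperHalfPlane.neg_smul _ z)

theorem exists_mem_of_mem_deck {g : SL(2, ℝ)} (h : g ∈ S.deck) :
    ∃ γ ∈ S.Γ, (g = γ ∨ g = -γ) ∧ ∀ z : ℍ, γ • z = g • z := by
  rcases h with h | h
  · exact ⟨g, h, Or.inl rfl, fun _ => rfl⟩
  · exact ⟨-g, h, Or.inr (neg_neg g).symm, fun z => SL2_neg_smul g z⟩

theorem proj_eq_iff {z w : ℍ} : S.proj z = S.proj w ↔ ∃ γ ∈ S.deck, γ • w = z := by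
  have : S.proj z = S.proj w ↔ ∃ γ ∈ S.Γ, γ • w = z := by
    rw [proj, proj, Quotient.eq]
    change z ∈ MulAction.orbit S.Γ w ↔ _
    simp [MulAction.mem_orbit_iff, Subgroup.smul_def]
  rw [this]
  refine ⟨fun ⟨γ, h, e⟩ => ⟨γ, mem_deck_of_mem h, e⟩, fun ⟨γ, h, e⟩ => ?_⟩
  obtain ⟨γ', h', -, e'⟩ := exists_mem_of_mem_deck h
  exact ⟨γ', h', (e' w).trans e⟩

theorem proj_smul {γ : SL(2, ℝ)} (h : γ ∈ S.deck) (z : ℍ) : S.proj (γ • z) = S.proj z :=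
  proj_eq_iff.2 ⟨γ, h, rfl⟩

theorem eq_one_or_neg_one_of_fixed {γ : SL(2, ℝ)} (h : γ ∈ S.deck) {z : ℍ} (hz : γ • z = z) :
    γ = 1 ∨ γ = -1 := by
  obtain ⟨γ', h', -, e'⟩ := exists_mem_of_mem_deck h
  have hf := S.free γ' h' ⟨z, (e' z).trans hz⟩
  refine eq_one_or_neg_one_of_smul_eq (z := stdPoint 0 0) (w := stdPoint 1 0) ?_
    ((e' _).symm.trans (hf _)) ((e' _).symm.trans (hf _))
  intro h
  exact zero_ne_one (stdPoint_injective h).1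

variable (S) in
theorem isCoveringMap_proj : IsCoveringMap S.proj := by
  have := S.discrete
  -- If `-1 ∈ Γ`, then `Γ` itself does not act freely. Its image in the permutations of ℍ does, and
  -- has the same orbits.
  let G := (MulAction.toPermHom S.Γ ℍ).range
  have key : ∀ g : G, ∃ γ : S.Γ, ∀ z : ℍ, g • z = γ • z := by
    rintro ⟨_, γ, rfl⟩
    exact ⟨γ, fun z => rfl⟩
  have hq : IsQuotientCoveringMap S.proj G :=
    { (isQuotientMap_quotient_mk' : Topology.IsQuotientMap S.proj) with
      continuous_const_smul := fun g => by
        obtain ⟨γ, h⟩ := key g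
        have hγ : Continuous fun z : ℍ => (γ : SL(2, ℝ)) • z := continuous_const_smul _
        exact hγ.congr fun z => (h z).symm
      apply_eq_iff_mem_orbit := by
        intro z w
        rw [proj, proj, Quotient.eq]
        change z ∈ MulAction.orbit S.Γ w ↔ _
        constructor
        · rintro ⟨γ, h⟩
          exact ⟨⟨_, γ, rfl⟩, h⟩
        · rintro ⟨g, h⟩
          obtain ⟨γ, hγ⟩ := key g
          exact ⟨γ, (hγ w).symm.trans h⟩
      disjoint := fun z => by
        obtain ⟨U, hU, h⟩ := ProperlyDiscontinuousSMul.exists_nhds_image_smul_eq_self S.Γ z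
        refine ⟨U, hU, fun g hg => ?_⟩
        obtain ⟨γ, hγ⟩ := key g
        have hz : γ • z = z := h γ (by simpa only [hγ] using hg)
        ext w
        exact congrArg _ ((hγ w).trans (S.free γ γ.2 ⟨z, hz⟩ w)) }
  exact hq.isCoveringMap

/-- Two lifts of the same map from a connected space differ by a deck transformation. -/
theorem exists_deck_of_proj_eq {A : Type*} [TopologicalSpace A] [PreconnectedSpace A] (a₀ : A)
    {f f' : A → ℍ} (hf : Continuous f) (hf' : Continuous f')
    (h : ∀ a, S.proj (f' a) = S.proj (f a)) : ∃ γ ∈ S.deck, ∀ a, f' a = γ • f a := by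
  obtain ⟨γ, hγ, e⟩ := proj_eq_iff.1 (h a₀)
  refine ⟨γ, hγ, fun a => congrFun (S.isCoveringMap_proj.eq_of_comp_eq hf'
    ((continuous_const_smul γ).comp hf) ?_ a₀ e.symm) a⟩
  funext a
  exact (h a).trans (proj_smul hγ _).symm

/-- Two lifts of one curve differ by a deck transformation, and an isometry of this kind is
determined up to sign by its values at the two points `p 0 ≠ p 1`. This turns periodicity and
coincidence of curves in the surface into membership in the deck group. -/
theorem proj_smul_eq_iff {p : ℝ → ℍ} (hp : Continuous p) (h01 : p 0 ≠ p 1) (a b : SL(2, ℝ)) :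
    (∀ u, S.proj (b • p u) = S.proj (a • p u)) ↔ b * a⁻¹ ∈ S.deck := by
  constructor
  · intro h
    obtain ⟨γ, hγ, e⟩ := exists_deck_of_proj_eq 0 ((continuous_const_smul a).comp hp)
      ((continuous_const_smul b).comp hp) h
    have hfix : ∀ u, ((γ * a)⁻¹ * b) • p u = p u := fun u => by
      rw [mul_smul, inv_smul_eq_iff, mul_smul]
      exact e u
    rcases eq_one_or_neg_one_of_smul_eq h01 (hfix 0) (hfix 1) with h1 | h1
    · rw [inv_mul_eq_iff_eq_mul, mul_one] at h1
      rwa [h1, mul_inv_cancel_right]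
    · rw [inv_mul_eq_iff_eq_mul, mul_neg, mul_one] at h1
      rwa [h1, neg_mul, mul_inv_cancel_right, neg_mem_deck_iff]
  · intro h u
    have := proj_smul h (a • p u)
    rwa [← mul_smul, inv_mul_cancel_right] at this

theorem periodic_geodesic_iff {g : SL(2, ℝ)} {x : ℝ} :
    Function.Periodic (S.geodesic g) x ↔ g * dilation x * g⁻¹ ∈ S.deck := by
  have hp : Continuous fun t => stdPoint t 0 :=
    continuous_stdPoint.comp (by fun_prop : Continuous fun t : ℝ => (t, (0 : ℝ)))
  rw [← proj_smul_eq_iff hp fun h => zero_ne_one (stdPoint_injective h).1]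
  simp only [mul_smul, dilation_smul_stdPoint]
  rfl

theorem continuous_stdPoint_right (t : ℝ) : Continuous fun u => stdPoint t u :=
  continuous_stdPoint.comp (by fun_prop : Continuous fun u : ℝ => (t, u))

theorem periodic_horocycle_iff {g : SL(2, ℝ)} {t s : ℝ} :
    Function.Periodic (S.horocycle g t) s ↔ g * shear (s * Real.exp t) * g⁻¹ ∈ S.deck := by
  rw [← proj_smul_eq_iff (continuous_stdPoint_right t)
    fun h => zero_ne_one (stdPoint_injective h).2]
  simp only [mul_smul, shear_smul_stdPoint]
  rfl

theorem horocycle_eq_iff {g k : SL(2, ℝ)} {t₀ t₁ s : ℝ} :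
    (∀ u, S.horocycle g t₁ (s + u) = S.horocycle (k * halfTurn) (-t₀) u) ↔
      g * (dilation t₁ * shear s * dilation t₀ * halfTurn) * k⁻¹ ∈ S.deck := by
  have h1 : ∀ u, g • stdPoint t₁ (s + u) = (g * (dilation t₁ * shear s)) • stdPoint 0 u := by
    intro u
    rw [mul_smul, mul_smul]
    have := shear_smul_stdPoint s 0 u
    rw [Real.exp_zero, mul_one] at this
    rw [this, dilation_smul_stdPoint, zero_add, add_comm]
  have h2 : ∀ u, (k * halfTurn) • stdPoint (-t₀) u =
      (k * halfTurn * dilation (-t₀)) • stdPoint 0 u := by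
    intro u
    rw [mul_smul _ (dilation _), dilation_smul_stdPoint, zero_add]
  have h3 : g * (dilation t₁ * shear s) * (k * halfTurn * dilation (-t₀))⁻¹ =
      -(g * (dilation t₁ * shear s * dilation t₀ * halfTurn) * k⁻¹) := by
    rw [mul_inv_rev, mul_inv_rev, dilation_neg, inv_inv, halfTurn_inv]
    simp only [mul_assoc, neg_mul, mul_neg]
  rw [← neg_mem_deck_iff, ← h3, ← proj_smul_eq_iff (continuous_stdPoint_right 0)
    fun h => zero_ne_one (stdPoint_injective h).2]
  simp only [← h1, ← h2]
  rfl

end DecoratedHyperbolicSurface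

/-! ### Normal forms by trace -/

theorem exists_SL2 {a b c d : ℝ} (h : a * d - b * c = 1) :
    ∃ g : SL(2, ℝ), g 0 0 = a ∧ g 0 1 = b ∧ g 1 0 = c ∧ g 1 1 = d :=
  ⟨⟨!![a, b; c, d], by rw [Matrix.det_fin_two_of, h]⟩, by simp⟩

/-- Fixed points solve a real quadratic with leading coefficient `m 1 0` and discriminant `trace² -
4 < 0`; the witness is its root in the upper half-plane. -/
theorem exists_smul_eq_self {m : SL(2, ℝ)} (hc : m 1 0 ≠ 0)
    (ht : |Matrix.trace (m : Matrix (Fin 2) (Fin 2) ℝ)| < 2) : ∃ z : ℍ, m • z = z := by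
  rw [Matrix.trace_fin_two, abs_lt] at ht
  have hd := SL2_det m
  have hD : 0 < 4 - (m 0 0 + m 1 1) ^ 2 := by nlinarith
  refine ⟨⟨⟨(m 0 0 - m 1 1) / (2 * m 1 0), Real.sqrt (4 - (m 0 0 + m 1 1) ^ 2) / (2 * |m 1 0|)⟩,
    div_pos (Real.sqrt_pos.2 hD) (by positivity)⟩, ?_⟩
  rw [smul_eq_self_iff_re_im]
  constructor
  · change m 0 0 * ((m 0 0 - m 1 1) / (2 * m 1 0)) + m 0 1 = (m 0 0 - m 1 1) / (2 * m 1 0) *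
      (m 1 0 * ((m 0 0 - m 1 1) / (2 * m 1 0)) + m 1 1) -
        m 1 0 * (Real.sqrt (4 - (m 0 0 + m 1 1) ^ 2) / (2 * |m 1 0|)) ^ 2
    rw [div_pow, Real.sq_sqrt hD.le, mul_pow, sq_abs]
    field_simp
    linear_combination (-4) * hd
  · change m 0 0 * (Real.sqrt (4 - (m 0 0 + m 1 1) ^ 2) / (2 * |m 1 0|)) =
      2 * m 1 0 * ((m 0 0 - m 1 1) / (2 * m 1 0)) *
        (Real.sqrt (4 - (m 0 0 + m 1 1) ^ 2) / (2 * |m 1 0|)) +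
      m 1 1 * (Real.sqrt (4 - (m 0 0 + m 1 1) ^ 2) / (2 * |m 1 0|))
    have : 2 * m 1 0 * ((m 0 0 - m 1 1) / (2 * m 1 0)) = m 0 0 - m 1 1 := by field_simp
    rw [this]
    ring

theorem exists_conj_dilation {m : SL(2, ℝ)} (hc : m 1 0 ≠ 0)
    (ht : 2 < Matrix.trace (m : Matrix (Fin 2) (Fin 2) ℝ)) :
    ∃ (x : ℝ) (a : SL(2, ℝ)), 0 < x ∧ m = a * dilation x * a⁻¹ := by
  rw [Matrix.trace_fin_two] at ht
  have hd := SL2_det m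
  set y := Real.arcosh ((m 0 0 + m 1 1) / 2) with hy
  have hy0 : 0 < y := Real.arcosh_pos (by linarith)
  have hcosh : Real.cosh y = (m 0 0 + m 1 1) / 2 := Real.cosh_arcosh (by linarith)
  rw [Real.cosh_eq] at hcosh
  set l := Real.exp y with hl
  set l' := Real.exp (-y) with hl'
  have hll : l * l' = 1 := by rw [hl, hl', ← Real.exp_add]; simp
  have hlt : l - l' ≠ 0 := (sub_pos.2 (Real.exp_lt_exp.2 (by linarith))).ne'
  -- The columns are eigenvectors for the eigenvalues `l` and `l'`, the second one scaled to make
  -- the determinant 1.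
  obtain ⟨a, h00, h01, h10, h11⟩ := exists_SL2 (a := l - m 1 1)
    (b := (l' - m 1 1) / (m 1 0 * (l - l'))) (c := m 1 0) (d := 1 / (l - l'))
    (by field_simp; ring)
  refine ⟨2 * y, a, by linarith, ?_⟩
  · rw [eq_mul_inv_iff_mul_eq]
    have e : 2 * y / 2 = y := by ring
    have hs : m 0 0 = l + l' - m 1 1 := by linarith
    rw [hs] at hd
    apply SL2_ext <;> simp only [SL2_mul_apply] <;>
      simp [h00, h01, h10, h11, dilation, e, ← hl, ← hl', hs] <;> field_simp
    · linear_combination (-1) * hd + hll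
    · linear_combination (-1) * hd + hll
    · ring
    · ring

theorem exists_conj_shear {m : SL(2, ℝ)} (hc : m 1 0 ≠ 0)
    (ht : Matrix.trace (m : Matrix (Fin 2) (Fin 2) ℝ) = 2) :
    ∃ (L : ℝ) (a : SL(2, ℝ)), L ≠ 0 ∧ m = a * shear L * a⁻¹ := by
  rw [Matrix.trace_fin_two] at ht
  have hd := SL2_det m
  have hs : m 1 1 = 2 - m 0 0 := by linarith
  rw [hs] at hd
  -- The first column spans the eigenspace for the eigenvalue 1; the second completes it to a Jordan
  -- basis of determinant 1.
  obtain ⟨a, h00, h01, h10, h11⟩ := exists_SL2 (a := m 0 0 - 1) (b := -1 / m 1 0) (c := m 1 0)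
    (d := 0) (by field_simp; ring)
  refine ⟨-1 / m 1 0, a, by simpa using hc, ?_⟩
  · rw [eq_mul_inv_iff_mul_eq]
    apply SL2_ext <;> simp only [SL2_mul_apply] <;> simp [h00, h01, h10, h11, shear, hs] <;> field_simp
    · linear_combination (-1) * hd
    all_goals ring

/-! ### Holonomy, free homotopy and geodesic length -/

namespace DecoratedHyperbolicSurface

variable {S : DecoratedHyperbolicSurface}

/-- The closed curve `β` lifts to a path in `ℍ` whose ends are related by the deck
transformation `γ`. -/
def HasHolonomy (S : DecoratedHyperbolicSurface) (β : ClosedCurve S.Surface) (γ : SL(2, ℝ)) :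
    Prop :=
  γ ∈ S.deck ∧ ∃ f : C(I, ℍ), (∀ t, S.proj (f t) = β.path t) ∧ f 1 = γ • f 0

theorem eq_or_eq_neg_of_smul_eq {γ δ : SL(2, ℝ)} (hγ : γ ∈ S.deck) (hδ : δ ∈ S.deck) {z : ℍ}
    (h : γ • z = δ • z) : γ = δ ∨ γ = -δ := by
  have := eq_one_or_neg_one_of_fixed (mul_mem (inv_mem hδ) hγ) (z := z)
    (by rw [mul_smul, h, inv_smul_smul])
  simpa only [inv_mul_eq_iff_eq_mul, mul_one, mul_neg] using this

/-- Lift the homotopy to ℍ. Its two sides cover the same path of base points, so a single deck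
transformation `η` relates them throughout; it is the first holonomy up to sign, and a conjugate of
the second. -/
theorem abs_trace_eq_of_freelyHomotopic {β δ : ClosedCurve S.Surface} {γ γ' : SL(2, ℝ)}
    (hβ : S.HasHolonomy β γ) (hδ : S.HasHolonomy δ γ') (h : β.FreelyHomotopic δ) :
    |Matrix.trace (γ : Matrix (Fin 2) (Fin 2) ℝ)| =
      |Matrix.trace (γ' : Matrix (Fin 2) (Fin 2) ℝ)| := by
  obtain ⟨hγ, f, hf, hf1⟩ := hβ
  obtain ⟨hγ', f', hf', hf1'⟩ := hδ
  obtain ⟨H, H0, H1, Hs⟩ := h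
  let cov := S.isCoveringMap_proj
  let K := cov.liftHomotopy H f (fun a => (H0 a).trans (hf a).symm)
  have hK : ∀ p, S.proj (K p) = H p := congrFun (cov.liftHomotopy_lifts H f _)
  have hK0 : ∀ t, K (0, t) = f t := cov.liftHomotopy_zero H f _
  obtain ⟨η, hη, e⟩ := exists_deck_of_proj_eq (S := S) (0 : I)
    (f := fun s => K (s, 0)) (f' := fun s => K (s, 1)) (by fun_prop) (by fun_prop)
    (fun s => by rw [hK, hK, Hs])
  obtain ⟨ξ, hξ, e'⟩ := exists_deck_of_proj_eq (S := S) (0 : I)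
    (f := fun t => K (1, t)) (f' := f') (by fun_prop) (by fun_prop)
    (fun s => by rw [hK, hf', H1])
  have h1 : γ = η ∨ γ = -η := by
    refine eq_or_eq_neg_of_smul_eq hγ hη (z := f 0) ?_
    rw [← hf1, ← hK0, ← hK0]
    exact e 0
  have h2 : γ' = ξ * η * ξ⁻¹ ∨ γ' = -(ξ * η * ξ⁻¹) := by
    refine eq_or_eq_neg_of_smul_eq hγ' (mul_mem (mul_mem hξ hη) (inv_mem hξ)) (z := f' 0) ?_
    rw [← hf1', e' 0, e' 1, ← mul_smul, inv_mul_cancel_right, mul_smul]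
    exact congrArg _ (e 1)
  rw [abs_eq_of_eq_or_neg h1, abs_eq_of_eq_or_neg h2, trace_conj]

/-- The Euclidean segment from `z` to `w`. -/
def euclideanSegment (s : I) (z w : ℍ) : ℍ :=
  ⟨(1 - (s : ℝ) : ℝ) * z + (s : ℝ) * w, by
    have h1 := z.im_pos
    have h2 := w.im_pos
    have h3 := s.2.1
    have h4 := s.2.2
    simp only [Complex.add_im, Complex.im_ofReal_mul,
      UpperHalfPlane.coe_im]
    rcases h3.eq_or_lt with h | h
    · rw [← h]; simpa using h1
    · have := mul_pos h h2
      have := mul_nonneg (sub_nonneg.2 h4) h1.le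
      linarith⟩

theorem coe_euclideanSegment (s : I) (z w : ℍ) :
    ((euclideanSegment s z w : ℍ) : ℂ) = (1 - (s : ℝ) : ℝ) * z + (s : ℝ) * w := rfl

theorem continuous_euclideanSegment :
    Continuous fun p : I × ℍ × ℍ => euclideanSegment p.1 p.2.1 p.2.2 := by
  rw [UpperHalfPlane.isEmbedding_coe.continuous_iff]
  change Continuous fun p : I × ℍ × ℍ =>
    ((1 - (p.1 : ℝ) : ℝ) : ℂ) * (p.2.1 : ℂ) + ((p.1 : ℝ) : ℂ) * (p.2.2 : ℂ)
  have h := UpperHalfPlane.continuous_coe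
  fun_prop

/-- In the coordinate given by `a`, join the two lifts by Euclidean segments. An affine `m` maps
segments to segments with the same parameter, so each intermediate curve closes up in the quotient.
-/
theorem freelyHomotopic_of_affine {β δ : ClosedCurve S.Surface} {a m : SL(2, ℝ)} {c d : ℝ}
    (hm : ∀ z : ℍ, ((m • z : ℍ) : ℂ) = c * z + d)
    (hβ : S.HasHolonomy β (a * m * a⁻¹)) (hδ : S.HasHolonomy δ (a * m * a⁻¹)) :
    β.FreelyHomotopic δ := by
  obtain ⟨hγ, f, hf, hf1⟩ := hβ
  obtain ⟨-, f', hf', hf1'⟩ := hδ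
  have ha := continuous_const_smul (T := ℍ) a
  have ha' := continuous_const_smul (T := ℍ) a⁻¹
  refine ⟨⟨fun p => S.proj (a • euclideanSegment p.1 (a⁻¹ • f p.2) (a⁻¹ • f' p.2)), ?_⟩, ?_, ?_, ?_⟩
  · refine S.continuous_proj.comp (ha.comp (continuous_euclideanSegment.comp
      (continuous_fst.prodMk (Continuous.prodMk ?_ ?_))))
    · exact ha'.comp (f.continuous.comp continuous_snd)
    · exact ha'.comp (f'.continuous.comp continuous_snd)
  · intro t
    have : euclideanSegment 0 (a⁻¹ • f t) (a⁻¹ • f' t) = a⁻¹ • f t := by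
      apply UpperHalfPlane.ext; simp [coe_euclideanSegment]
    simp only [ContinuousMap.coe_mk, this, smul_inv_smul, hf]
  · intro t
    have : euclideanSegment 1 (a⁻¹ • f t) (a⁻¹ • f' t) = a⁻¹ • f' t := by
      apply UpperHalfPlane.ext; simp [coe_euclideanSegment]
    simp only [ContinuousMap.coe_mk, this, smul_inv_smul, hf']
  · intro s
    have : euclideanSegment s (a⁻¹ • f 1) (a⁻¹ • f' 1) =
        m • euclideanSegment s (a⁻¹ • f 0) (a⁻¹ • f' 0) := by
      apply UpperHalfPlane.ext
      rw [hm, coe_euclideanSegment, coe_euclideanSegment, hf1, hf1']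
      simp only [mul_smul, inv_smul_smul, hm]
      push_cast
      ring
    simp only [ContinuousMap.coe_mk, this]
    rw [← proj_smul hγ (a • euclideanSegment s (a⁻¹ • f 0) (a⁻¹ • f' 0))]
    simp only [mul_smul, inv_smul_smul]

theorem HasHolonomy.neg {β : ClosedCurve S.Surface} {γ : SL(2, ℝ)} (h : S.HasHolonomy β γ) :
    S.HasHolonomy β (-γ) := by
  obtain ⟨hγ, f, hf, hf1⟩ := h
  exact ⟨neg_mem_deck_iff.2 hγ, f, hf, by rw [hf1, SL2_neg_smul]⟩

theorem hasHolonomy_geodesic {g : SL(2, ℝ)} {x : ℝ} (h : Function.Periodic (S.geodesic g) x) :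
    S.HasHolonomy (closedCurveOfPeriodic (S.geodesic g) (S.continuous_geodesic g) x h)
      (g * dilation x * g⁻¹) := by
  refine ⟨periodic_geodesic_iff.1 h, ⟨fun t => g • stdPoint ((1 - (t : ℝ)) * 0 + (t : ℝ) * x) 0,
    ((continuous_const_smul g).comp (continuous_stdPoint.comp
      (by fun_prop : Continuous fun t : I => ((1 - (t : ℝ)) * 0 + (t : ℝ) * x, (0 : ℝ)))))⟩,
    fun t => rfl, ?_⟩
  simp [mul_smul, dilation_smul_stdPoint]

theorem hasHolonomy_horocycle {g : SL(2, ℝ)} {t L : ℝ} (h : Function.Periodic (S.horocycle g t) L) :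
    S.HasHolonomy (closedCurveOfPeriodic (S.horocycle g t) (S.continuous_horocycle g t) L h)
      (g * shear (L * Real.exp t) * g⁻¹) := by
  refine ⟨periodic_horocycle_iff.1 h, ⟨fun u => g • stdPoint t ((1 - (u : ℝ)) * 0 + (u : ℝ) * L),
    ((continuous_const_smul g).comp (continuous_stdPoint.comp
      (by fun_prop : Continuous fun u : I => (t, (1 - (u : ℝ)) * 0 + (u : ℝ) * L))))⟩,
    fun t => rfl, ?_⟩
  simp [mul_smul, shear_smul_stdPoint]

/-- The trace formula for the length of the geodesic representative. -/
theorem HasGeodesicLength.abs_trace {β : ClosedCurve S.Surface} {γ : SL(2, ℝ)} {x : ℝ}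
    (hx : S.HasGeodesicLength β x) (hβ : S.HasHolonomy β γ) :
    |Matrix.trace (γ : Matrix (Fin 2) (Fin 2) ℝ)| = 2 * Real.cosh (x / 2) := by
  rcases hx with ⟨-, g, h, hom⟩ | ⟨rfl, g, L, h, -, hom⟩
  · rw [abs_trace_eq_of_freelyHomotopic hβ (hasHolonomy_geodesic h) hom, trace_conj, trace_dilation,
      abs_of_pos (mul_pos two_pos (Real.cosh_pos _))]
  · rw [abs_trace_eq_of_freelyHomotopic hβ (hasHolonomy_horocycle h) hom, trace_conj, trace_shear]
    simp

/-- With the sign chosen so that the trace is nonnegative, a trace below 2 gives a fixed point,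
against freeness; trace 2 gives a horocycle, and a larger trace a closed geodesic. The condition on
`m 1 0` rules out `±1`. -/
theorem exists_hasGeodesicLength {β : ClosedCurve S.Surface} {g m : SL(2, ℝ)} (hc : m 1 0 ≠ 0)
    (hβ : S.HasHolonomy β (g * m * g⁻¹)) : ∃ x, S.HasGeodesicLength β x := by
  wlog ht : 0 ≤ Matrix.trace (m : Matrix (Fin 2) (Fin 2) ℝ) generalizing m
  · refine this (m := -m) (by simpa using hc) (by simpa using hβ.neg) ?_
    simp only [Matrix.SpecialLinearGroup.coe_neg, Matrix.trace_neg]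
    linarith
  rcases lt_trichotomy (Matrix.trace (m : Matrix (Fin 2) (Fin 2) ℝ)) 2 with h | h | h
  · exfalso
    obtain ⟨z, hz⟩ := exists_smul_eq_self hc (by rwa [abs_of_nonneg ht])
    have := eq_one_or_neg_one_of_fixed hβ.1 (z := g • z)
      (by rw [← mul_smul, inv_mul_cancel_right, mul_smul, hz])
    rw [mul_inv_eq_iff_eq_mul, mul_inv_eq_iff_eq_mul, one_mul, neg_one_mul, mul_eq_left,
      ← mul_neg_one g, mul_right_inj] at this
    rcases this with rfl | rfl <;> simp at hc
  · obtain ⟨L, a, hL, rfl⟩ := exists_conj_shear hc h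
    have e : g * (a * shear L * a⁻¹) * g⁻¹ = g * a * shear (L * Real.exp 0) * (g * a)⁻¹ := by
      rw [Real.exp_zero, mul_one]; group
    rw [e] at hβ
    exact ⟨0, Or.inr ⟨rfl, g * a, L, periodic_horocycle_iff.2 hβ.1, hL,
      freelyHomotopic_of_affine (c := 1) (d := L * Real.exp 0)
        (fun z => by rw [coe_shear_smul]; simp) hβ (hasHolonomy_horocycle _)⟩⟩
  · obtain ⟨x, a, hx, rfl⟩ := exists_conj_dilation hc h
    have e : g * (a * dilation x * a⁻¹) * g⁻¹ = g * a * dilation x * (g * a)⁻¹ := by group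
    rw [e] at hβ
    exact ⟨x, Or.inl ⟨hx, g * a, periodic_geodesic_iff.2 hβ.1,
      freelyHomotopic_of_affine (c := Real.exp x) (d := 0)
        (fun z => by rw [coe_dilation_smul]; simp) hβ (hasHolonomy_geodesic _)⟩⟩

end DecoratedHyperbolicSurface

/-! ### Cusp widths and closed horocycles -/

theorem exists_eq_dilation_mul_shear {q : SL(2, ℝ)} (h10 : q 1 0 = 0) :
    ∃ τ b : ℝ, q = dilation τ * shear b ∨ q = -(dilation τ * shear b) := by
  wlog hpos : 0 ≤ q 0 0 generalizing q
  · obtain ⟨τ, b, h⟩ := this (q := -q) (by simpa using h10) (by simp; linarith)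
    exact ⟨τ, b, by rwa [neg_eq_iff_eq_neg, neg_inj, or_comm] at h⟩
  have hd := SL2_det q
  rw [h10, mul_zero, sub_zero] at hd
  have h00 : 0 < q 0 0 := hpos.lt_of_ne' (left_ne_zero_of_mul_eq_one hd)
  have e : 2 * Real.log (q 0 0) / 2 = Real.log (q 0 0) := by ring
  refine ⟨2 * Real.log (q 0 0), q 0 1 / q 0 0, Or.inl ?_⟩
  apply SL2_ext <;> simp only [SL2_mul_apply] <;>
    simp [dilation, shear, e, Real.exp_neg, Real.exp_log h00, h10]
  · field_simp
  · exact eq_inv_of_mul_eq_one_right hd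

namespace DecoratedHyperbolicSurface

variable {S : DecoratedHyperbolicSurface}

/-- The translation lengths of the deck transformations that are parabolic with fixed point
`h • ∞`, as measured in the coordinate given by `h`. -/
def shearPeriods (S : DecoratedHyperbolicSurface) (h : SL(2, ℝ)) : AddSubgroup ℝ where
  carrier := {u | h * shear u * h⁻¹ ∈ S.deck}
  add_mem' := fun {u v} hu hv => by
    have := mul_mem (show h * shear u * h⁻¹ ∈ S.deck from hu) hv
    have e : h * shear (u + v) * h⁻¹ = h * shear u * h⁻¹ * (h * shear v * h⁻¹) := by
      rw [shear_add]; group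
    rwa [Set.mem_ofPred_eq, e]
  zero_mem' := by simp [shear_zero, one_mem]
  neg_mem' := fun {u} hu => by
    have := inv_mem (show h * shear u * h⁻¹ ∈ S.deck from hu)
    rwa [mul_inv_rev, mul_inv_rev, inv_inv, ← shear_neg, ← mul_assoc] at this

theorem mem_shearPeriods_iff {h : SL(2, ℝ)} {u : ℝ} :
    u ∈ S.shearPeriods h ↔ h * shear u * h⁻¹ ∈ S.deck := Iff.rfl

/-- A period gives an element of `Γ` only up to sign. Doubling `u` squares that element, which
removes the sign and embeds the periods continuously into the discrete group `Γ`. -/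
theorem discreteTopology_shearPeriods (h : SL(2, ℝ)) : DiscreteTopology (S.shearPeriods h) := by
  have := S.discrete
  have hmem : ∀ u : S.shearPeriods h, h * shear (u + u) * h⁻¹ ∈ S.Γ := by
    rintro ⟨u, hu⟩
    have e : h * shear (u + u) * h⁻¹ = (h * shear u * h⁻¹) * (h * shear u * h⁻¹) := by
      rw [shear_add]; group
    rw [e]
    rcases hu with hu | hu
    · exact mul_mem hu hu
    · simpa using mul_mem hu hu
  refine DiscreteTopology.of_continuous_injective
    (f := fun u => (⟨_, hmem u⟩ : S.Γ)) (Continuous.subtype_mk ?_ _) ?_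
  · have := continuous_shear
    fun_prop
  · intro u v huv
    have h1 := congrArg Subtype.val huv
    simp only [mul_left_inj, mul_right_inj] at h1
    have := shear_injective h1
    exact Subtype.ext (by linarith)

/-- Conjugating the parabolic element at the cusp by `h` makes it fix ∞; it is then upper triangular
with equal diagonal entries, hence a nontrivial shear up to sign. -/
theorem exists_ne_zero_mem_shearPeriods {h : SL(2, ℝ)}
    (hc : IsCusp ((h : GL (Fin 2) ℝ) • (OnePoint.infty : OnePoint ℝ)) S.boundaryGroup) :
    ∃ u ∈ S.shearPeriods h, u ≠ 0 := by
  obtain ⟨_, ⟨γ, hγ, rfl⟩, hpar, hfix⟩ := hc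
  set k : GL (Fin 2) ℝ := (h : GL (Fin 2) ℝ) with hk
  set q : SL(2, ℝ) := h⁻¹ * γ * h with hq
  have hqk : (q : GL (Fin 2) ℝ) = k⁻¹ * Matrix.SpecialLinearGroup.toGL γ * k := by
    simp [hq, hk]
  have hq10 : (q : GL (Fin 2) ℝ) 1 0 = 0 := by
    rw [← OnePoint.smul_infty_eq_self_iff, hqk, mul_smul, mul_smul, hfix, inv_smul_smul]
  have hqpar : (q : GL (Fin 2) ℝ).IsParabolic := by
    rw [hqk]
    exact (Matrix.GeneralLinearGroup.isParabolic_conj_iff' _ _).2 hpar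
  rw [Matrix.GeneralLinearGroup.isParabolic_iff_of_upperTriangular hq10] at hqpar
  obtain ⟨h00, h01⟩ := hqpar
  change q 1 0 = 0 at hq10
  change q 0 0 = q 1 1 at h00
  change q 0 1 ≠ 0 at h01
  have hγq : h * q * h⁻¹ ∈ S.deck := by
    rw [hq]
    simpa only [mul_assoc, mul_inv_cancel_left, mul_inv_cancel, mul_one] using mem_deck_of_mem hγ
  obtain ⟨τ, b, e⟩ := exists_eq_dilation_mul_shear hq10
  have hτ : τ = 0 := by
    have : τ / 2 = -(τ / 2) := by
      rcases e with e | e <;> rw [e] at h00 <;> simp [SL2_mul_apply] at h00 <;>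
        simpa [dilation, shear] using h00
    linarith
  rw [hτ, dilation_zero, one_mul] at e
  refine ⟨b, mem_shearPeriods_iff.2 ?_, ?_⟩
  · rcases e with e | e <;> rw [e] at hγq
    · exact hγq
    · simpa using hγq
  · rintro rfl
    rcases e with e | e <;> rw [e, shear_zero] at h01 <;> simp at h01

theorem exists_width {h : SL(2, ℝ)}
    (hc : IsCusp ((h : GL (Fin 2) ℝ) • (OnePoint.infty : OnePoint ℝ)) S.boundaryGroup) :
    ∃ w : ℝ, 0 < w ∧ ∀ u, h * shear u * h⁻¹ ∈ S.deck ↔ ∃ n : ℤ, u = n * w := by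
  have := discreteTopology_shearPeriods (S := S) h
  obtain ⟨w, hw⟩ := (S.shearPeriods h).isAddCyclic_iff_exists_zmultiples_eq_top.1
    (AddSubgroup.discrete_iff_addCyclic.2 this)
  have hw' : ∀ u, u ∈ S.shearPeriods h ↔ ∃ n : ℤ, n * w = u := fun u => by
    rw [← hw, AddSubgroup.mem_zmultiples_iff]
    simp
  obtain ⟨u, hu, hu0⟩ := exists_ne_zero_mem_shearPeriods hc
  have hw0 : w ≠ 0 := by
    rintro rfl
    obtain ⟨n, rfl⟩ := (hw' u).1 hu
    simp at hu0
  refine ⟨|w|, abs_pos.2 hw0, fun u => ?_⟩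
  rw [← mem_shearPeriods_iff, hw']
  rcases abs_choice w with e | e <;> rw [e]
  · simp only [eq_comm]
  · constructor
    · rintro ⟨n, rfl⟩; exact ⟨-n, by push_cast; ring⟩
    · rintro ⟨n, rfl⟩; exact ⟨-n, by push_cast; ring⟩

/-- At height `exp t`, horocyclic arc length `s` is the Euclidean translation by `s * exp t`. -/
theorem closesUp_horocycle_iff {h : SL(2, ℝ)} {w : ℝ} (hw : 0 < w)
    (hper : ∀ u, h * shear u * h⁻¹ ∈ S.deck ↔ ∃ n : ℤ, u = n * w) {t ρ : ℝ} :
    ClosesUpWithLength (S.horocycle h t) ρ ↔ ρ * Real.exp t = w := by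
  have hexp := Real.exp_pos t
  have hp : ∀ s, Function.Periodic (S.horocycle h t) s ↔ ∃ n : ℤ, s * Real.exp t = n * w :=
    fun s => by rw [periodic_horocycle_iff, hper]
  simp only [ClosesUpWithLength, hp]
  have key : ∀ s, 0 < s → (∃ n : ℤ, s * Real.exp t = n * w) → w ≤ s * Real.exp t := by
    rintro s hs ⟨n, hn⟩
    have hnw : 0 < n * w := hn ▸ mul_pos hs hexp
    have hn0 : (0 : ℝ) < n := pos_of_mul_pos_left hnw hw.le
    have hn1 : (1 : ℝ) ≤ n := by exact_mod_cast (Int.cast_pos.1 hn0 : 0 < n)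
    rw [hn]
    exact le_mul_of_one_le_left hw.le hn1
  constructor
  · rintro ⟨hρ, hmem, hmin⟩
    refine le_antisymm ?_ (key ρ hρ hmem)
    have := hmin (w / Real.exp t) (div_pos hw hexp) ⟨1, by
      rw [div_mul_cancel₀ _ hexp.ne', Int.cast_one, one_mul]⟩
    rwa [le_div_iff₀ hexp] at this
  · intro e
    refine ⟨pos_of_mul_pos_left (e.symm ▸ hw) hexp.le, ⟨1, by simpa using e⟩, fun s hs hmem => ?_⟩
    have := key s hs hmem
    rw [← e] at this
    exact le_of_mul_le_mul_right this hexp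

end DecoratedHyperbolicSurface

/-! ### The matrix of a resolution -/

/-- In the coordinate given by an arc, the deck transformation belonging to a resolution. -/
def resolutionMatrix (t₀ t₁ s : ℝ) : SL(2, ℝ) := dilation t₁ * shear s * dilation t₀ * halfTurn

theorem resolutionMatrix_one_zero_ne (t₀ t₁ s : ℝ) : resolutionMatrix t₀ t₁ s 1 0 ≠ 0 := by
  simp only [resolutionMatrix, SL2_mul_apply]
  simp [dilation, shear, halfTurn]

theorem trace_resolutionMatrix (t₀ t₁ s : ℝ) :
    Matrix.trace (resolutionMatrix t₀ t₁ s : Matrix (Fin 2) (Fin 2) ℝ) =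
      s * Real.exp ((t₁ - t₀) / 2) := by
  rw [Matrix.trace_fin_two]
  have h : (t₁ - t₀) / 2 = t₁ / 2 + -(t₀ / 2) := by ring
  rw [h, Real.exp_add]
  simp only [resolutionMatrix, SL2_mul_apply]
  simp [dilation, shear, halfTurn]
  ring

/-- The turn `s` enters only through the left shear factor, and the cutting times otherwise only
through `t₁ + t₀`. Resolutions with the same sum thus differ by a shear. -/
theorem resolutionMatrix_eq (t₀ t₁ s : ℝ) :
    resolutionMatrix t₀ t₁ s = shear (s * Real.exp t₁) * (dilation (t₁ + t₀) * halfTurn) := by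
  rw [resolutionMatrix, dilation_mul_shear, dilation_add]
  simp only [mul_assoc]

theorem ClosesUpWithLength.of_shift {X : Type*} {f f' : ℝ → X} {s r : ℝ}
    (h : ∀ u, f (s + u) = f' u) (hf : ClosesUpWithLength f r) : ClosesUpWithLength f' r := by
  have hp : ∀ x, Function.Periodic f x ↔ Function.Periodic f' x := by
    intro x
    constructor
    · intro hx u
      rw [← h, ← h, ← add_assoc, hx]
    · intro hx u
      have := hx (u - s)
      rw [← h, ← h] at this
      convert this using 2 <;> ring
  exact ⟨hf.1, (hp r).1 hf.2.1, fun x hx hx' => hf.2.2 x hx ((hp x).2 hx')⟩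

/-! ### Arcs, their resolutions and the length formula -/

namespace DecoratedHyperbolicSurface
namespace GeodesicArc

variable {S : DecoratedHyperbolicSurface} {α : S.GeodesicArc}

theorem halfTurn_smul_infty (g : SL(2, ℝ)) :
    ((g * halfTurn : SL(2, ℝ)) : GL (Fin 2) ℝ) • (OnePoint.infty : OnePoint ℝ) =
      (g : GL (Fin 2) ℝ) • ((0 : ℝ) : OnePoint ℝ) := by
  rw [map_mul, mul_smul]
  congr 1
  have h00 : (halfTurn : GL (Fin 2) ℝ) 0 0 = 0 := rfl
  have h10 : (halfTurn : GL (Fin 2) ℝ) 1 0 = 1 := rfl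
  rw [OnePoint.smul_infty_eq_ite, h00, h10, if_neg one_ne_zero, zero_div]

/-- `w` and `w'` are the widths of the cusps at the two ends of `α`. -/
def HasWidths (α : S.GeodesicArc) (w w' : ℝ) : Prop :=
  0 < w ∧ 0 < w' ∧
  (∀ u, α.frame * shear u * α.frame⁻¹ ∈ S.deck ↔ ∃ n : ℤ, u = n * w) ∧
  (∀ t ρ, ClosesUpWithLength (α.endHorocycle t) ρ ↔ ρ * Real.exp t = w) ∧
  ∀ t ρ, ClosesUpWithLength (α.startHorocycle t) ρ ↔ ρ * Real.exp (-t) = w'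

variable (α) in
theorem exists_hasWidths : ∃ w w', α.HasWidths w w' := by
  obtain ⟨w, hw, hper⟩ := exists_width α.target_isCusp
  obtain ⟨w', hw', hper'⟩ := exists_width (S := S) (h := α.frame * halfTurn)
    (by rw [halfTurn_smul_infty]; exact α.source_isCusp)
  exact ⟨w, w', hw, hw', hper, fun t ρ => closesUp_horocycle_iff hw hper,
    fun t ρ => closesUp_horocycle_iff hw' hper'⟩

theorem exists_hasLength (α : S.GeodesicArc) : ∃ a, α.HasLength a := by
  obtain ⟨w, w', hw, hw', -, hend, hstart⟩ := α.exists_hasWidths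
  have h1 := S.r_pos α.source
  have h2 := S.r_pos α.target
  refine ⟨_, -Real.log (w' / S.r α.source), Real.log (w / S.r α.target), ?_, ?_, rfl⟩
  · rw [hstart, neg_neg, Real.exp_log (div_pos hw' h1), mul_div_cancel₀ _ h1.ne']
  · rw [hend, Real.exp_log (div_pos hw h2), mul_div_cancel₀ _ h2.ne']

theorem HasLength.exp_eq {a w w' : ℝ} (ha : α.HasLength a) (hw : α.HasWidths w w') :
    S.r α.source * S.r α.target * Real.exp a = w * w' := by
  obtain ⟨t₀, t₁, h0, h1, rfl⟩ := ha
  obtain ⟨-, -, -, hend, hstart⟩ := hw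
  rw [hstart] at h0
  rw [hend] at h1
  rw [← h0, ← h1, sub_eq_add_neg, Real.exp_add]
  ring

theorem joins_iff {w w' : ℝ} (hw : α.HasWidths w w') {t₀ t₁ ρ s : ℝ} :
    α.Joins t₀ t₁ ρ s ↔ t₀ < t₁ ∧ ρ * Real.exp t₁ = w ∧
      α.frame * resolutionMatrix t₀ t₁ s * α.frame⁻¹ ∈ S.deck := by
  rw [Joins, hw.2.2.2.1]
  exact and_congr_right fun _ => and_congr_right fun _ => horocycle_eq_iff

theorem Joins.start_width {w w' : ℝ} (hw : α.HasWidths w w') {t₀ t₁ ρ s : ℝ}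
    (h : α.Joins t₀ t₁ ρ s) : ρ * Real.exp (-t₀) = w' :=
  (hw.2.2.2.2 _ _).1 (h.2.1.of_shift h.2.2)

theorem hasHolonomy_resolution {t₀ t₁ ρ s : ℝ} (h : α.Joins t₀ t₁ ρ s) :
    S.HasHolonomy (α.resolution t₀ t₁ ρ s h)
      (α.frame * resolutionMatrix t₀ t₁ s * α.frame⁻¹) := by
  obtain ⟨w, w', hw⟩ := α.exists_hasWidths
  have hg : Continuous (geodesicH α.frame) := (continuous_const_smul α.frame).comp
    (continuous_stdPoint.comp (by fun_prop : Continuous fun t : ℝ => (t, (0 : ℝ))))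
  have hh : Continuous (horocycleH α.frame t₁) :=
    (continuous_const_smul α.frame).comp (continuous_stdPoint_right t₁)
  let p : Path (geodesicH α.frame t₀) (horocycleH α.frame t₁ s) :=
    (segmentPath (geodesicH α.frame) hg t₀ t₁).trans
      ((segmentPath (horocycleH α.frame t₁) hh 0 s).cast rfl rfl)
  refine ⟨((joins_iff hw).1 h).2.2, p.toContinuousMap, fun t => ?_, ?_⟩
  · change S.proj (p t) = ((segmentPath α.curve α.continuous_curve t₀ t₁).trans _) t
    simp only [p, Path.trans_apply]
    split_ifs <;> rfl
  · change p 1 = _ • p 0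
    rw [p.source, p.target, geodesicH, horocycleH, ← mul_smul, inv_mul_cancel_right, mul_smul,
      resolutionMatrix]
    have h1 := halfTurn_smul_stdPoint (-t₀)
    rw [neg_neg] at h1
    have h2 := shear_smul_stdPoint s 0 0
    rw [Real.exp_zero, mul_one, zero_add] at h2
    rw [mul_smul, mul_smul, mul_smul, h1, dilation_smul_stdPoint, neg_add_cancel, h2,
      dilation_smul_stdPoint, zero_add]

/-- Some `γ` carries the initial end of the lift to its final end, so after a half turn it fixes ∞
in the frame of the arc and is a dilation times a shear up to sign. -/
theorem exists_dilation_mem_deck (h : α.source = α.target) :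
    ∃ τ b : ℝ, α.frame * (shear b * (dilation τ * halfTurn)) * α.frame⁻¹ ∈ S.deck := by
  obtain ⟨⟨_, γ, hγ, rfl⟩, e⟩ := Quotient.exact h.symm
  replace e : (γ : GL (Fin 2) ℝ) • (α.frame : GL (Fin 2) ℝ) • ((0 : ℝ) : OnePoint ℝ) =
    (α.frame : GL (Fin 2) ℝ) • (OnePoint.infty : OnePoint ℝ) := congrArg Subtype.val e
  set q : SL(2, ℝ) := α.frame⁻¹ * γ * (α.frame * halfTurn) with hq
  have hq10 : q 1 0 = 0 := by
    refine OnePoint.smul_infty_eq_self_iff (g := (q : GL (Fin 2) ℝ)) |>.1 ?_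
    rw [hq, map_mul, mul_smul, halfTurn_smul_infty, map_mul, mul_smul, e, map_inv, inv_smul_smul]
  have hγ' : α.frame * (q * halfTurn) * α.frame⁻¹ ∈ S.deck := by
    have : α.frame * (q * halfTurn) * α.frame⁻¹ = -γ := by
      rw [hq, mul_assoc _ _ halfTurn, mul_assoc _ _ halfTurn, halfTurn_mul_halfTurn]
      simp [mul_assoc]
    rw [this]
    exact neg_mem_deck_iff.2 (mem_deck_of_mem hγ)
  obtain ⟨τ, b, hb⟩ := exists_eq_dilation_mul_shear hq10
  refine ⟨τ, b * Real.exp τ, ?_⟩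
  rw [← mul_assoc (shear _), ← dilation_mul_shear]
  rcases hb with hb | hb <;> rw [hb] at hγ'
  · exact hγ'
  · simpa using hγ'

theorem exists_joins (h : α.source = α.target) : ∃ t₀ t₁ ρ s : ℝ, 0 < s ∧ s < ρ ∧
    α.Joins t₀ t₁ ρ s ∧ α.Joins t₀ t₁ ρ (s - ρ) := by
  obtain ⟨w, w', hw⟩ := α.exists_hasWidths
  obtain ⟨τ, b, hb⟩ := exists_dilation_mem_deck h
  have hw0 := hw.1
  have hmem : ∀ n : ℤ, α.frame * (shear (b + n * w) * (dilation τ * halfTurn)) * α.frame⁻¹ ∈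
      S.deck := by
    intro n
    have e : α.frame * (shear (b + n * w) * (dilation τ * halfTurn)) * α.frame⁻¹ =
        α.frame * shear (n * w) * α.frame⁻¹ *
          (α.frame * (shear b * (dilation τ * halfTurn)) * α.frame⁻¹) := by
      rw [add_comm, shear_add]; group
    rw [e]
    exact mul_mem ((hw.2.2.1 _).2 ⟨n, rfl⟩) hb
  -- With no shear the element would have trace 0, a half turn with a fixed point in ℍ.
  have hne : ∀ n : ℤ, b + n * w ≠ 0 := by
    intro n hn
    have h1 := hmem n
    have e : shear (b + n * w) * (dilation τ * halfTurn) = resolutionMatrix 0 τ 0 := by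
      rw [resolutionMatrix_eq, hn, zero_mul, add_zero]
    rw [e] at h1
    obtain ⟨z, hz⟩ := exists_smul_eq_self (resolutionMatrix_one_zero_ne 0 τ 0)
      (by rw [trace_resolutionMatrix]; simp)
    have h2 := eq_one_or_neg_one_of_fixed h1 (z := α.frame • z)
      (by rw [← mul_smul, inv_mul_cancel_right, mul_smul, hz])
    have h3 := resolutionMatrix_one_zero_ne 0 τ 0
    rw [mul_inv_eq_iff_eq_mul, mul_inv_eq_iff_eq_mul, one_mul, neg_one_mul, mul_eq_left,
      ← mul_neg_one α.frame, mul_right_inj] at h2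
    rcases h2 with h2 | h2 <;> rw [h2] at h3 <;> simp at h3
  -- Reduce the translation modulo the width to `0 < c < w`; `c` is the right turn and `c - w` the
  -- left turn.
  set n : ℤ := -⌊b / w⌋ with hn
  set c := b + n * w with hc
  have hcw : c = Int.fract (b / w) * w := by
    rw [hc, hn, ← Int.self_sub_floor, sub_mul, div_mul_cancel₀ _ hw0.ne']
    push_cast
    ring
  have hc0 : 0 < c := (hcw ▸ mul_nonneg (Int.fract_nonneg _) hw0.le : 0 ≤ c).lt_of_ne' (hne n)
  have hc1 : c < w := hcw ▸ mul_lt_of_lt_one_left hw0 (Int.fract_lt_one _)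
  have hexp := Real.exp_pos (τ / 2 + 1)
  have e : τ / 2 + 1 + (τ / 2 - 1) = τ := by ring
  -- Only the sum `τ` of the cutting times is prescribed; the offset 1 is an arbitrary positive
  -- number ensuring `t₀ < t₁`.
  refine ⟨τ / 2 - 1, τ / 2 + 1, w / Real.exp (τ / 2 + 1), c / Real.exp (τ / 2 + 1),
    div_pos hc0 hexp, div_lt_div_of_pos_right hc1 hexp, (joins_iff hw).2 ⟨by linarith,
      div_mul_cancel₀ _ hexp.ne', ?_⟩, (joins_iff hw).2 ⟨by linarith,
      div_mul_cancel₀ _ hexp.ne', ?_⟩⟩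
  · rw [resolutionMatrix_eq, e, div_mul_cancel₀ _ hexp.ne']
    exact hmem n
  · rw [resolutionMatrix_eq, e, ← sub_div, div_mul_cancel₀ _ hexp.ne']
    have := hmem (n - 1)
    push_cast at this
    convert this using 5
    rw [hc]; ring

/-- The left and the right turn together make a full turn around the puncture. -/
theorem Joins.full_turn {t₀ t₁ ρ s t₀' t₁' ρ' s' : ℝ} (h : α.Joins t₀ t₁ ρ s)
    (h' : α.Joins t₀' t₁' ρ' s') (hs0 : -ρ < s) (hs1 : s < 0) (hs0' : 0 < s') (hs1' : s' < ρ') :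
    s' / ρ' - s / ρ = 1 := by
  obtain ⟨w, w', hw⟩ := α.exists_hasWidths
  have hρ : 0 < ρ := h.2.1.1
  have hρ' : 0 < ρ' := h'.2.1.1
  obtain ⟨-, e1, hm⟩ := (joins_iff hw).1 h
  obtain ⟨-, e1', hm'⟩ := (joins_iff hw).1 h'
  have e0 := h.start_width hw
  have e0' := h'.start_width hw
  -- The same `ρ` is measured at both ends, so `exp (t₁ + t₀)` is the ratio of the cusp widths.
  have hsum : t₁ + t₀ = t₁' + t₀' := by
    apply Real.exp_injective
    have h1 : Real.exp (t₁ + t₀) = w / w' := by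
      rw [eq_div_iff hw.2.1.ne', ← e0, ← e1, Real.exp_add, Real.exp_neg]
      field_simp
    have h2 : Real.exp (t₁' + t₀') = w / w' := by
      rw [eq_div_iff hw.2.1.ne', ← e0', ← e1', Real.exp_add, Real.exp_neg]
      field_simp
    rw [h1, h2]
  -- The quotient of the two holonomies is a parabolic deck transformation, hence a shear by an
  -- integer multiple of `w`; the bounds on the turns leave only the multiple 1.
  have e : α.frame * resolutionMatrix t₀' t₁' s' * α.frame⁻¹ *
      (α.frame * resolutionMatrix t₀ t₁ s * α.frame⁻¹)⁻¹ =
      α.frame * shear (s' * Real.exp t₁' - s * Real.exp t₁) * α.frame⁻¹ := by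
    rw [resolutionMatrix_eq, resolutionMatrix_eq, hsum, sub_eq_add_neg, shear_add, shear_neg]
    group
  have := mul_mem hm' (inv_mem hm)
  rw [e, hw.2.2.1] at this
  obtain ⟨n, hn⟩ := this
  have hn' : s' / ρ' - s / ρ = n := by
    apply mul_right_cancel₀ hw.1.ne'
    rw [← hn, sub_mul]
    nth_rw 1 [← e1']
    rw [← e1]
    field_simp
  have b0 : 0 < s' / ρ' := div_pos hs0' hρ'
  have b1 : s' / ρ' < 1 := (div_lt_one hρ').2 hs1'
  have b2 : s / ρ < 0 := div_neg_of_neg_of_pos hs1 hρ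
  have b3 : -1 < s / ρ := by rw [lt_div_iff₀ hρ]; linarith
  have n0 : (0 : ℝ) < n := by linarith
  have n1 : (n : ℝ) < 2 := by linarith
  have n0' : 0 < n := by exact_mod_cast n0
  have n1' : n < 2 := by exact_mod_cast n1
  have : n = 1 := by omega
  rw [hn', this, Int.cast_one]

theorem Joins.two_mul_cosh {t₀ t₁ ρ s a x : ℝ} (h : α.Joins t₀ t₁ ρ s)
    (hst : α.source = α.target) (ha : α.HasLength a)
    (hx : S.HasGeodesicLength (α.resolution t₀ t₁ ρ s h) x) :
    2 * Real.cosh (x / 2) = |s| / ρ * (S.r α.target * Real.exp (a / 2)) := by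
  obtain ⟨w, w', hw⟩ := α.exists_hasWidths
  have hρ : 0 < ρ := h.2.1.1
  have htr := hx.abs_trace (hasHolonomy_resolution h)
  rw [trace_conj, trace_resolutionMatrix, abs_mul, abs_of_pos (Real.exp_pos _)] at htr
  have hE := ha.exp_eq hw
  have e0 := h.start_width hw
  obtain ⟨-, e1, -⟩ := (joins_iff hw).1 h
  -- Both sides are positive with square `w * w'`, whichever horocycle is used.
  have key : ρ * Real.exp ((t₁ - t₀) / 2) = S.r α.target * Real.exp (a / 2) := by
    rw [← sq_eq_sq₀ (mul_nonneg hρ.le (Real.exp_pos _).le)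
      (mul_nonneg (S.r_pos _).le (Real.exp_pos _).le), mul_pow, mul_pow,
      ← Real.exp_nat_mul, ← Real.exp_nat_mul]
    have h1 : ((2 : ℕ) : ℝ) * ((t₁ - t₀) / 2) = t₁ + -t₀ := by push_cast; ring
    have h2 : ((2 : ℕ) : ℝ) * (a / 2) = a := by push_cast; ring
    rw [h1, h2, Real.exp_add, sq, sq]
    rw [hst, ← e0, ← e1] at hE
    rw [hE]
    ring
  rw [← htr, ← key]
  field_simp

end GeodesicArc
end DecoratedHyperbolicSurface
end

theorem mainTheorem12 (S : DecoratedHyperbolicSurface) (v : S.Puncture) (α : S.GeodesicArc)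
    (hsource : α.source = v) (htarget : α.target = v) :
    (∃ a, α.HasLength a) ∧
    (∃ β₁, α.IsLeftResolution β₁) ∧ (∃ β₂, α.IsRightResolution β₂) ∧
    (∀ β, α.IsLeftResolution β ∨ α.IsRightResolution β → ∃ x, S.HasGeodesicLength β x) ∧
    ∀ (a x y : ℝ) (β₁ β₂ : ClosedCurve S.Surface), α.HasLength a →
      α.IsLeftResolution β₁ → α.IsRightResolution β₂ →
      S.HasGeodesicLength β₁ x → S.HasGeodesicLength β₂ y →
      Real.exp (a / 2) = 2 / S.r v * (Real.cosh (x / 2) + Real.cosh (y / 2)) := by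
  have hst : α.source = α.target := hsource.trans htarget.symm
  obtain ⟨t₀, t₁, ρ, s, hs0, hs1, hr, hl⟩ := DecoratedHyperbolicSurface.GeodesicArc.exists_joins hst
  refine ⟨α.exists_hasLength, ⟨_, t₀, t₁, ρ, s - ρ, hl, by linarith, by linarith, rfl⟩,
    ⟨_, t₀, t₁, ρ, s, hr, hs0, hs1, rfl⟩, ?_, ?_⟩
  · rintro β (⟨t₀, t₁, ρ, s, h, -, -, rfl⟩ | ⟨t₀, t₁, ρ, s, h, -, -, rfl⟩) <;>
      exact DecoratedHyperbolicSurface.exists_hasGeodesicLength (resolutionMatrix_one_zero_ne _ _ _)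
        (DecoratedHyperbolicSurface.GeodesicArc.hasHolonomy_resolution h)
  · rintro a x y _ _ ha ⟨t₀, t₁, ρ, s, h, hs0, hs1, rfl⟩ ⟨t₀', t₁', ρ', s', h', hs0', hs1', rfl⟩
      hx hy
    have h1 := h.two_mul_cosh hst ha hx
    have h2 := h'.two_mul_cosh hst ha hy
    have h3 := h.full_turn h' hs0 hs1 hs0' hs1'
    rw [htarget, abs_of_neg hs1, neg_div] at h1
    rw [htarget, abs_of_pos hs0'] at h2
    have hr := S.r_pos v
    rw [div_mul_eq_mul_div, eq_div_iff hr.ne']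
    linear_combination (-(S.r v * Real.exp (a / 2))) * h3 - h1 - h2
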